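/- Let $M$ be a smooth manifold without boundary (finite-dimensional, Hausdorff, second countable), $\mathfrak X(M)$ its Lie algebra of smooth vector fields, and $\Omega^k(M)$ the space of smooth $k$-forms, with $\Omega^k(M)=0$ for $k<0$. For a bivector field $\Lambda$ and a 1-form $\alpha$, the vector field $\#_\Lambda(\alpha)$ is given by $\beta(\#_\Lambda(\alpha))=\Lambda(\alpha,\beta)$ for all 1-forms $\beta$, where $(X\wedge Y)(\alpha,\beta)=\alpha(X)\beta(Y)-\alpha(Y)\beta(X)$. The contraction $i(\Lambda):\Omega^k(M)\to\Omega^{k-2}(M)$ is the $C^\infty(M,\mathbb R)$-linear map, additive and $C^\infty(M,\mathbb R)$-linear in $\Lambda$, with $i(X\wedge Y)\alpha=\alpha(X,Y,\cdot,\dots,\cdot)$ (and it is $0$ for $k<2$). The Schouten bracket $[\cdot,\cdot]$ of multivector fields is normalized by $[X,Q]=\mathcal L_XQ$ for a vector field $X$ and $$[X_1\wedge\dots\wedge X_p,\,Q]=\sum_{i=1}^p(-1)^{i+1}X_1\wedge\dots\wedge\widehat{X_i}\wedge\dots\wedge X_p\wedge[X_i,Q].$$ A Jacobi structure on $M$ is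 a pair $(\Lambda,E)$ of a bivector field $\Lambda$ and a vector field $E$ with $$[\Lambda,\Lambda]=2E\wedge\Lambda,\qquad [E,\Lambda]=0.$$ For a Jacobi structure $(\Lambda,E)$, the operator $\delta:\Omega^r(M)\oplus\Omega^{r-1}(M)\to\Omega^{r-1}(M)\oplus\Omega^{r-2}(M)$ given by $$\delta(\alpha,\beta)=\bigl(i(\Lambda)d\alpha-d\,i(\Lambda)\alpha+r\,i_E\alpha+(-1)^r\mathcal L_E\beta,\;\; i(\Lambda)d\beta-d\,i(\Lambda)\beta+(r-1)\,i_E\beta+(-1)^r i(\Lambda)\alpha\bigr)$$ satisfies $\delta^2=0$. The Lichnerowicz–Jacobi homology $H_k^{LJ}(M,\Lambda,E)$ is the homology $\ker\delta/\operatorname{im}\delta$ of this complex at $\Omega^k(M)\oplus\Omega^{k-1}(M)$. If $a\in C^\infty(M,\mathbb R)$ is positive everywhere, the conformal change of $(\Lambda,E)$ by $a$ is the Jacobi structure $(\Lambda_a,E_a)$ with $$\Lambda_a=a\Lambda,\qquad E_a=\#_\Lambda(da)+aE.$$ **Theorem.** The LJ-homology is invariant under conformal changes of the Jacobi structure: for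 every Jacobi structure $(\Lambda,E)$ on $M$, every everywhere positive $a\in C^\infty(M,\mathbb R)$ and every integer $k\ge 0$, there is an isomorphism of real vector spaces $$H_k^{LJ}(M,\Lambda,E)\cong H_k^{LJ}(M,\Lambda_a,E_a).$$ -/

import Mathlib

set_option linter.unusedSectionVars false
set_option linter.unusedSimpArgs false

open scoped Manifold ContDiff Bundle

noncomputable section

/-! ## Functions and vector fields on a smooth manifold -/

section Manifolds
open VectorField

/-- The algebra `C^∞(M, ℝ)` of a smooth `n`-manifold. -/
abbrev SmoothFun (n : ℕ) (M : Type*) [TopologicalSpace M]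
    [ChartedSpace (EuclideanSpace ℝ (Fin n)) M] : Type _ :=
  ContMDiffMap (𝓡 n) 𝓘(ℝ, ℝ) M ℝ ∞

/-- The smooth vector fields `𝔛(M)`: smooth sections of the tangent bundle. -/
abbrev SmoothVF (n : ℕ) (M : Type*) [TopologicalSpace M]
    [ChartedSpace (EuclideanSpace ℝ (Fin n)) M] [IsManifold (𝓡 n) ∞ M] : Type _ :=
  ContMDiffSection (𝓡 n) (EuclideanSpace ℝ (Fin n)) ∞ (TangentSpace (𝓡 n) : M → Type _)

section VectorFields
variable {n : ℕ} {M : Type*} [TopologicalSpace M]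
    [ChartedSpace (EuclideanSpace ℝ (Fin n)) M] [IsManifold (𝓡 n) ∞ M]

namespace SmoothVF

lemma mdiff (f : SmoothFun n M) (x : M) : MDifferentiableAt (𝓡 n) 𝓘(ℝ, ℝ) f x :=
  (f.contMDiff x).mdifferentiableAt (by simp)

lemma mdiff_section (X : SmoothVF n M) (x : M) :
    MDifferentiableAt (𝓡 n) (𝓡 n).tangent
      (fun y => (⟨y, X y⟩ : TangentBundle (𝓡 n) M)) x :=
  (X.contMDiff x).mdifferentiableAt (by simp)

/-- `(f X)(x) = f(x) X(x)`. -/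
instance : SMul (SmoothFun n M) (SmoothVF n M) :=
  ⟨fun f X => ⟨(f : M → ℝ) • (X : ∀ x, TangentSpace (𝓡 n) x), f.contMDiff.smul_section X.contMDiff⟩⟩

lemma smul_apply (f : SmoothFun n M) (X : SmoothVF n M) (x : M) : (f • X) x = f x • X x := rfl

instance : Module (SmoothFun n M) (SmoothVF n M) where
  one_smul X := by ext x; simp [smul_apply]
  mul_smul f g X := by ext x; simp [smul_apply, mul_smul]
  smul_zero f := by ext x; simp [smul_apply]
  smul_add f X Y := by ext x; simp [smul_apply]
  add_smul f g X := by ext x; simp [smul_apply, add_smul]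
  zero_smul X := by ext x; simp [smul_apply]

instance : IsScalarTower ℝ (SmoothFun n M) (SmoothVF n M) :=
  ⟨fun r f X => by ext x; simp [smul_apply, mul_smul]⟩

/-- The Lie bracket `[X, Y]` of vector fields. -/
instance : Bracket (SmoothVF n M) (SmoothVF n M) :=
  ⟨fun X Y => ⟨mlieBracket (𝓡 n) X Y, by
    have : IsManifold (𝓡 n) (((⊤ : ℕ∞) : WithTop ℕ∞) + 1) M := ‹IsManifold (𝓡 n) ∞ M›
    have : IsManifold (𝓡 n) (minSmoothness ℝ 2) M :=
      IsManifold.of_le (n := ∞) (by simpa using ENat.LEInfty.out)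
    exact fun x => ContMDiffAt.mlieBracket_vectorField (m := ⊤) (n := ⊤)
      (X.contMDiff x) (Y.contMDiff x) (by simp)⟩⟩

lemma lie_apply (X Y : SmoothVF n M) (x : M) : ⁅X, Y⁆ x = mlieBracket (𝓡 n) X Y x := rfl

/-- The derivative `X(f)` of a function along a vector field. -/
instance : Bracket (SmoothVF n M) (SmoothFun n M) :=
  ⟨fun X f => ⟨fun x => mvfderiv (𝓡 n) f x (X x), by
    have h1 := (f.contMDiff.contMDiff_tangentMap (m := ∞) (by simp)).comp X.contMDiff
    exact (contMDiff_snd_tangentBundle_modelSpace ℝ 𝓘(ℝ, ℝ)).comp h1⟩⟩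

lemma lie_fun_apply (X : SmoothVF n M) (f : SmoothFun n M) (x : M) :
    ⁅X, f⁆ x = mvfderiv (𝓡 n) f x (X x) := rfl

instance : LieRing (SmoothVF n M) where
  add_lie X Y Z := by
    ext x
    exact mlieBracket_add_left (mdiff_section X x) (mdiff_section Y x)
  lie_add X Y Z := by
    ext x
    exact mlieBracket_add_right (mdiff_section Y x) (mdiff_section Z x)
  lie_self X := by ext x; simp [lie_apply]
  leibniz_lie X Y Z := by
    ext x
    have : IsManifold (𝓡 n) (minSmoothness ℝ 3) M :=
      IsManifold.of_le (n := ∞) (by simpa using ENat.LEInfty.out)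
    have h (X : SmoothVF n M) := (X.contMDiff x).of_le (m := minSmoothness ℝ 2) 
      (by simpa using ENat.LEInfty.out)
    exact leibniz_identity_mlieBracket_apply (h X) (h Y) (h Z)

instance : LieAlgebra ℝ (SmoothVF n M) where
  lie_smul r X Y := by
    ext x
    exact mlieBracket_const_smul_right (mdiff_section Y x)

lemma lie_smul_right (X Y : SmoothVF n M) (f : SmoothFun n M) :
    ⁅X, f • Y⁆ = f • ⁅X, Y⁆ + ⁅X, f⁆ • Y := by
  ext x
  rw [add_comm]
  exact mlieBracket_smul_right (mdiff f x) (mdiff_section Y x)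

lemma lie_lie_fun (X Y : SmoothVF n M) (f : SmoothFun n M) :
    ⁅X, ⁅Y, f⁆⁆ = ⁅⁅X, Y⁆, f⁆ + ⁅Y, ⁅X, f⁆⁆ := by
  have key (Z : SmoothVF n M) : ⁅X, ⁅Y, f⁆⁆ • Z = (⁅⁅X, Y⁆, f⁆ + ⁅Y, ⁅X, f⁆⁆) • Z := by
    have h := leibniz_lie X Y (f • Z)
    have h' := congrArg (fun W => f • W) (leibniz_lie X Y Z)
    simp only [lie_smul_right, lie_add, smul_add] at h h'
    rw [add_smul]
    linear_combination (norm := module) h - h'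
  ext x
  by_cases hX : X x = 0
  · by_cases hY : Y x = 0
    · have : ⁅X, Y⁆ x = 0 := by
        rw [lie_apply, mlieBracket, mlieBracketWithin_eq_zero_of_eq_zero hX hY]
      simp [lie_fun_apply, hX, hY, this]
    · have := DFunLike.congr_fun (key Y) x
      simpa only [smul_apply, smul_left_injective ℝ hY |>.eq_iff] using this
  · have := DFunLike.congr_fun (key X) x
    simpa only [smul_apply, smul_left_injective ℝ hX |>.eq_iff] using this

instance : LieRingModule (SmoothVF n M) (SmoothFun n M) where
  add_lie X Y f := by ext x; simp [lie_fun_apply]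
  lie_add X f g := by
    ext x
    simp only [lie_fun_apply, ContMDiffMap.coe_add, mvfderiv_add (mdiff f x) (mdiff g x)]
    rfl
  leibniz_lie X Y f := lie_lie_fun X Y f

instance : LieRinehartRing (SmoothFun n M) (SmoothVF n M) where
  lie_smul_eq_mul' f g X := by ext x; simp [lie_fun_apply, smul_apply]
  leibniz_mul_right' X f g := by
    ext x
    simp only [lie_fun_apply, ContMDiffMap.coe_mul, ContMDiffMap.coe_add, smul_eq_mul, Pi.add_apply, Pi.mul_apply, mvfderiv_mul (mdiff f x) (mdiff g x)]
    simp; ring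
  leibniz_smul_right' X Y f := lie_smul_right X Y f

instance : LieModule ℝ (SmoothVF n M) (SmoothFun n M) where
  smul_lie r X f := by ext x; simp [lie_fun_apply]
  lie_smul r X f := by
    have : r • f = algebraMap ℝ (SmoothFun n M) r * f := by rw [Algebra.smul_def]
    rw [this, LieRinehartRing.leibniz_mul_right]
    have : ⁅X, algebraMap ℝ (SmoothFun n M) r⁆ = 0 := by
      ext x
      rw [lie_fun_apply]
      exact congrArg (· (X x)) (mvfderiv_const (I := 𝓡 n) r)
    rw [this]; simp [Algebra.smul_def]

instance : LieRinehartAlgebra ℝ (SmoothFun n M) (SmoothVF n M) where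

end SmoothVF
end VectorFields

end Manifolds

/-! ## Cartan calculus

The algebra of forms and multivectors is developed for a Lie-Rinehart algebra `(A, L)`; it is applied
to `A = C^∞(M, ℝ)` and `L = 𝔛(M)`. -/

namespace LJ
open Function

section Forms
variable {R A L : Type*} [CommRing R] [CommRing A] [LieRing L] [Module A L] [LieRingModule L A]
  [LieRinehartRing A L] [Algebra R A] [LieAlgebra R L] [LieRinehartAlgebra R A L]

variable (A L) in
/-- `k`-forms: alternating `A`-multilinear maps `L × ⋯ × L → A`. For `A = C^∞(M, ℝ)` and
`L = 𝔛(M)` these are the differential `k`-forms `Ω^k(M)`. -/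
abbrev Form (k : ℕ) : Type _ := L [⋀^Fin k]→ₗ[A] A

variable {k : ℕ}

/-- The interior product: `(i_X α)(Y_1, …, Y_k) = α(X, Y_1, …, Y_k)`. -/
def contract (X : L) (α : Form A L (k + 1)) : Form A L k := α.curryLeft X

lemma contract_apply (X : L) (α : Form A L (k + 1)) (v : Fin k → L) :
    contract X α v = α (Fin.cons X v) := rfl

lemma sum_update_update (X : L) (α : Form A L k) (v : Fin k → L) (i : Fin k) (z : L) :
    ∑ j, α (update (update v i z) j ⁅X, update v i z j⁆) =
      α (update v i ⁅X, z⁆) +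
        ∑ j ∈ Finset.univ.erase i, α (update (update v j ⁅X, v j⁆) i z) := by
  rw [← Finset.add_sum_erase _ _ (Finset.mem_univ i)]
  simp only [update_self, update_idem]
  congr 1
  refine Finset.sum_congr rfl fun j hj => ?_
  have hj : j ≠ i := (Finset.mem_erase.1 hj).1
  rw [update_of_ne hj, update_comm hj]

/-- The Lie derivative of forms:
`(L_X α)(Y_1, …, Y_k) = X (α(Y_1, …, Y_k)) - ∑_j α(Y_1, …, [X, Y_j], …, Y_k)`. -/
def lieDeriv (X : L) (α : Form A L k) : Form A L k where
  toFun v := ⁅X, α v⁆ - ∑ j, α (update v j ⁅X, v j⁆)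
  map_update_add' := by
    intro inst v i x y
    obtain rfl : inst = instDecidableEqFin k := Subsingleton.elim _ _
    simp only [sum_update_update, α.map_update_add, lie_add, Finset.sum_add_distrib]
    ring
  map_update_smul' := by
    intro inst v i c x
    obtain rfl : inst = instDecidableEqFin k := Subsingleton.elim _ _
    simp only [sum_update_update, α.map_update_smul, α.map_update_add,
      LieRinehartRing.leibniz_smul_right, smul_eq_mul, LieRinehartRing.leibniz_mul_right,
      ← Finset.mul_sum]
    ring
  map_eq_zero_of_eq' := by
    intro v i j hv hij
    have h0 : α v = 0 := α.map_eq_zero_of_eq v hv hij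
    have hs : ∑ m, α (update v m ⁅X, v m⁆) =
        α (update v i ⁅X, v i⁆) + α (update v j ⁅X, v j⁆) := by
      rw [← Finset.sum_pair (f := fun m => α (update v m ⁅X, v m⁆)) hij]
      symm
      refine Finset.sum_subset (Finset.subset_univ _) fun m _ hm => ?_
      simp only [Finset.mem_insert, Finset.mem_singleton, not_or] at hm
      refine α.map_eq_zero_of_eq _ ?_ hij
      rw [update_of_ne (Ne.symm hm.1), update_of_ne (Ne.symm hm.2), hv]
    have hsw : update v j ⁅X, v j⁆ = update v i ⁅X, v i⁆ ∘ Equiv.swap i j := by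
      funext m
      by_cases h1 : m = i
      · subst h1; simp [update_of_ne hij, update_of_ne hij.symm, hv]
      · by_cases h2 : m = j
        · subst h2; simp [hv]
        · simp [Equiv.swap_apply_of_ne_of_ne h1 h2, update_of_ne h1, update_of_ne h2]
    rw [h0, hs, hsw, α.map_swap _ hij]
    simp

lemma lieDeriv_apply (X : L) (α : Form A L k) (v : Fin k → L) :
    lieDeriv X α v = ⁅X, α v⁆ - ∑ j, α (update v j ⁅X, v j⁆) := rfl

/-- The right-hand side of Koszul's formula for `dα`. For `i < j` the vector `[X_i, X_j]` is written
in the `i`-th slot and the `j`-th slot is deleted; moving `[X_i, X_j]` to the front gives the usual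
`∑_{i<j} (-1)^{i+j} α([X_i, X_j], X_0, …, X̂_i, …, X̂_j, …, X_k)`. -/
def koszul (α : Form A L k) (v : Fin (k + 1) → L) : A :=
  ∑ i : Fin (k + 1), (-1) ^ (i : ℕ) * ⁅v i, α (i.removeNth v)⁆ +
    ∑ i : Fin (k + 1), ∑ j ∈ Finset.Ioi i,
      (-1) ^ (j : ℕ) * α (j.removeNth (update v i ⁅v i, v j⁆))

lemma koszul_zero (α : Form A L 0) (v : Fin 1 → L) : koszul α v = ⁅v 0, α ![]⁆ := by
  have : Finset.Ioi (0 : Fin 1) = ∅ := by decide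
  simp [koszul, this, Subsingleton.elim (Fin.removeNth 0 v) ![]]

lemma koszul_cons (α : Form A L (k + 1)) (X : L) (v : Fin (k + 1) → L) :
    koszul α (Fin.cons X v) = lieDeriv X α v - koszul (contract X α) v := by
  have hI : Finset.Ioi (0 : Fin (k + 2)) = Finset.univ.map (Fin.succEmb (k + 1)) := by
    ext i; simp [Fin.exists_succ_eq, Fin.pos_iff_ne_zero]
  have e1 (j : Fin (k + 1)) (w : Fin (k + 1) → L) :
      j.succ.removeNth (Fin.cons X w : Fin (k + 2) → L) = Fin.cons X (j.removeNth w) := by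
    ext m; refine Fin.cases ?_ (fun m => ?_) m <;> simp [Fin.removeNth_apply]
  have e2 (j : Fin (k + 1)) (Y : L) :
      α (j.succ.removeNth (update (Fin.cons X v : Fin (k + 2) → L) 0 Y)) =
        (-1) ^ (j : ℕ) * α (update v j Y) := by
    rw [Fin.update_cons_zero]
    have h := α.map_insertNth j Y (j.removeNth v)
    rw [Fin.insertNth_removeNth] at h
    rw [h]
    have : j.succ.removeNth (Fin.cons Y v : Fin (k + 2) → L) = Fin.cons Y (j.removeNth v) := by
      ext m; refine Fin.cases ?_ (fun m => ?_) m <;> simp [Fin.removeNth_apply]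
    rw [this, zsmul_eq_mul, ← mul_assoc]
    push_cast
    rw [← pow_add, Even.neg_one_pow ⟨_, rfl⟩, one_mul]
    rfl
  simp only [koszul, lieDeriv_apply]
  rw [Fin.sum_univ_succ, Fin.sum_univ_succ (n := k + 1)]
  rw [hI, Finset.sum_map]
  simp only [Fin.coe_succEmb, Fin.Ioi_succ, Finset.sum_map, Fin.cons_succ, Fin.cons_zero, e1, e2,
    Fin.val_succ, Fin.val_zero, pow_zero, one_mul, Fin.removeNth_zero, Fin.tail_cons,
    contract_apply, ← Fin.cons_update, pow_succ, mul_neg_one, neg_mul, mul_one,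
    Finset.sum_neg_distrib]
  have (j : ℕ) (x : A) : (-1) ^ j * ((-1) ^ j * x) = x := by
    rw [← mul_assoc, ← pow_add, Even.neg_one_pow ⟨_, rfl⟩, one_mul]
  simp only [this]
  ring

lemma koszul_smul (f : A) (α : Form A L k) (v : Fin (k + 1) → L) :
    koszul (f • α) v = f * koszul α v +
      ∑ i : Fin (k + 1), (-1) ^ (i : ℕ) * (⁅v i, f⁆ * α (i.removeNth v)) := by
  simp only [koszul, AlternatingMap.smul_apply, smul_eq_mul, LieRinehartRing.leibniz_mul_right,
    mul_add, Finset.sum_add_distrib, Finset.mul_sum]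
  simp only [mul_left_comm _ f]
  ring

lemma koszul_add (α β : Form A L k) (v : Fin (k + 1) → L) :
    koszul (α + β) v = koszul α v + koszul β v := by
  simp only [koszul, AlternatingMap.add_apply, lie_add, mul_add, Finset.sum_add_distrib]
  ring

lemma smul_lie_eq (f : A) (X Y : L) : ⁅f • X, Y⁆ = f • ⁅X, Y⁆ - ⁅Y, f⁆ • X := by
  rw [← lie_skew, LieRinehartRing.leibniz_smul_right, ← lie_skew X Y]
  module

/-- The Koszul expression is alternating and `A`-multilinear. -/
lemma exists_koszul : ∀ (k : ℕ) (α : Form A L k), ∃ β : Form A L (k + 1), ∀ v, β v = koszul α v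
  | 0, α => by
    refine ⟨AlternatingMap.ofSubsingleton A L A (0 : Fin 1)
      { toFun := fun X => ⁅X, α ![]⁆
        map_add' := fun X Y => add_lie _ _ _
        map_smul' := fun f X => by simp }, fun v => ?_⟩
    rw [koszul_zero]
    rfl
  | k + 1, α => by
    have ih (X : L) := exists_koszul k (contract X α)
    choose γ hγ using ih
    let F : L →ₗ[A] MultilinearMap A (fun _ : Fin (k + 1) => L) A :=
      { toFun := fun X => (lieDeriv X α - γ X).toMultilinearMap
        map_add' := by
          intro X Y
          ext v
          have : contract (X + Y) α = contract X α + contract Y α := by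
            simp [contract]
          simp [hγ, this, koszul_add, lieDeriv_apply, α.map_update_add, Finset.sum_add_distrib]
          ring
        map_smul' := by
          intro f X
          ext v
          have hc : contract (f • X) α = f • contract X α := by
            simp [contract]
          have hj (j : Fin (k + 1)) : α (update v j X) =
              (-1) ^ (j : ℕ) * contract X α (j.removeNth v) := by
            have h := α.map_insertNth j X (j.removeNth v)
            rw [Fin.insertNth_removeNth] at h
            rw [h, zsmul_eq_mul]
            push_cast
            rfl
          have hL : lieDeriv (f • X) α v =
              f * lieDeriv X α v + ∑ j, ⁅v j, f⁆ * α (update v j X) := by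
            simp only [lieDeriv_apply, smul_lie_eq, α.map_update_sub, α.map_update_smul,
              Finset.sum_sub_distrib, LieRinehartRing.lie_smul_eq_mul, smul_eq_mul,
              ← Finset.mul_sum]
            ring
          have hs : ∑ j, ⁅v j, f⁆ * α (update v j X) =
              ∑ j : Fin (k + 1), (-1) ^ (j : ℕ) * (⁅v j, f⁆ * contract X α (j.removeNth v)) :=
            Finset.sum_congr rfl fun j _ => by rw [hj]; ring
          simp only [AlternatingMap.coe_multilinearMap, AlternatingMap.sub_apply, hγ, hc, hL, hs,
            koszul_smul, smul_apply, RingHom.id_apply, smul_eq_mul]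
          ring }
    have hF (X : L) (w : Fin (k + 1) → L) : F X w = lieDeriv X α w - γ X w := rfl
    have hF0 (X : L) (w : Fin (k + 1) → L) : F X w = koszul α (Fin.cons X w) := by
      rw [hF, hγ, koszul_cons]
    have key (X : L) (w : Fin k → L) : F X (Fin.cons X w) = 0 := by
      rw [hF, lieDeriv_apply, Fin.sum_univ_succ, hγ]
      cases k with
      | zero =>
        rw [koszul_zero]
        simp [contract_apply, Subsingleton.elim w ![], ← Fin.cons_update]
      | succ k =>
        rw [koszul_cons]
        have h0 : contract X (contract X α) = 0 := by
          ext u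
          exact α.map_eq_zero_of_eq _ (i := 0) (j := 1) rfl (by simp)
        have hz : koszul (0 : Form A L k) w = 0 := by simp [koszul]
        simp [h0, hz, lieDeriv_apply, contract_apply, ← Fin.cons_update]
        exact α.map_coord_zero 0 rfl
    refine ⟨{ F.uncurryLeft with map_eq_zero_of_eq' := ?_ }, fun v => ?_⟩
    · have hcase (v : Fin (k + 2) → L) (j : Fin (k + 1)) (h : v 0 = v j.succ) :
          F (v 0) (Fin.tail v) = 0 := by
        have h1 := (lieDeriv (v 0) α - γ (v 0)).map_insertNth j (v 0) (j.removeNth (Fin.tail v))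
        have h2 : (j.insertNth (v 0) (j.removeNth (Fin.tail v)) : Fin (k + 1) → L) = Fin.tail v := by
          rw [Fin.insertNth_removeNth, h]
          exact update_eq_self j (Fin.tail v)
        rw [h2] at h1
        have h3 := key (v 0) (j.removeNth (Fin.tail v))
        rw [hF] at h3 ⊢
        rw [AlternatingMap.sub_apply] at h1
        rw [h1]
        have : (lieDeriv (v 0) α - γ (v 0)) (Matrix.vecCons (v 0) (j.removeNth (Fin.tail v))) = 0 :=
          h3
        rw [this, smul_zero]
      intro v i j hv hij
      change F (v 0) (Fin.tail v) = 0
      rcases Fin.eq_zero_or_eq_succ i with rfl | ⟨i, rfl⟩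
      · rcases Fin.eq_zero_or_eq_succ j with rfl | ⟨j, rfl⟩
        · exact absurd rfl hij
        · exact hcase v j hv
      · rcases Fin.eq_zero_or_eq_succ j with rfl | ⟨j, rfl⟩
        · exact hcase v i hv.symm
        · exact (lieDeriv (v 0) α - γ (v 0)).map_eq_zero_of_eq (Fin.tail v) (i := i) (j := j) hv
            (by rintro rfl; exact hij rfl)
    · change F (v 0) (Fin.tail v) = _
      rw [hF0, Fin.cons_self_tail]

/-- The exterior derivative, by Koszul's formula
`dα(X_0, …, X_k) = ∑_i (-1)^i X_i(α(X_0, …, X̂_i, …, X_k))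
  + ∑_{i<j} (-1)^{i+j} α([X_i, X_j], X_0, …, X̂_i, …, X̂_j, …, X_k)`. -/
def extD (α : Form A L k) : Form A L (k + 1) where
  toFun := koszul α
  map_update_add' := by
    obtain ⟨β, hβ⟩ := exists_koszul k α
    intro inst v i x y
    simp only [← hβ, β.map_update_add]
  map_update_smul' := by
    obtain ⟨β, hβ⟩ := exists_koszul k α
    intro inst v i c x
    simp only [← hβ, β.map_update_smul]
  map_eq_zero_of_eq' := by
    obtain ⟨β, hβ⟩ := exists_koszul k α
    intro v i j hv hij
    rw [← hβ, β.map_eq_zero_of_eq v hv hij]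



variable (R) in
/-- `i_X` as an `R`-linear map. -/
def contractₗ (X : L) : Form A L (k + 1) →ₗ[R] Form A L k where
  toFun := contract X
  map_add' α β := by ext v; rfl
  map_smul' r α := by ext v; rfl

variable (R) in
/-- `L_X` on forms as an `R`-linear map. -/
def lieDerivₗ (X : L) : Form A L k →ₗ[R] Form A L k where
  toFun := lieDeriv X
  map_add' α β := by
    ext v
    simp only [lieDeriv_apply, AlternatingMap.add_apply, lie_add, Finset.sum_add_distrib]
    ring
  map_smul' r α := by
    ext v
    simp only [lieDeriv_apply, AlternatingMap.smul_apply, lie_smul, RingHom.id_apply, smul_sub,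
      Finset.smul_sum]

variable (R) in
/-- `d` as an `R`-linear map. -/
def extDₗ : Form A L k →ₗ[R] Form A L (k + 1) where
  toFun := extD
  map_add' α β := by ext v; exact koszul_add α β v
  map_smul' r α := by
    ext v
    change koszul (r • α) v = r • koszul α v
    simp only [koszul, AlternatingMap.smul_apply, lie_smul, smul_add, Finset.smul_sum,
      mul_smul_comm]

/-! ### Multivectors -/

variable (A L) in
/-- `k`-vectors: the `k`-th exterior power of the `A`-module `L`. For `A = C^∞(M, ℝ)` and
`L = 𝔛(M)` these are the `k`-vector fields `𝒱^k(M)`, i.e. the sections of `⋀^k TM`. -/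
abbrev Multivector (k : ℕ) : Type _ := ⋀[A]^k L

section Bilinear
variable {N : Type*} [AddCommGroup N] [Module A N]

/-- The decomposable `2`-vector `X ∧ Y`. -/
def wedgeMk (X Y : L) : Multivector A L 2 := exteriorPower.ιMulti A 2 ![X, Y]

lemma coe_wedgeMk (X Y : L) :
    ((wedgeMk X Y : Multivector A L 2) : ExteriorAlgebra A L) =
      ExteriorAlgebra.ι A X * ExteriorAlgebra.ι A Y := by
  simp [wedgeMk, ExteriorAlgebra.ιMulti_apply]

/-- The `A`-linear map on `2`-vectors with `X ∧ Y ↦ f X Y`, for `f` bilinear and alternating. -/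
def liftWedge (f : L →ₗ[A] L →ₗ[A] N) (hf : ∀ X, f X X = 0) : Multivector A L 2 →ₗ[A] N :=
  exteriorPower.alternatingMapLinearEquiv
    { toFun := fun v => f (v 0) (v 1)
      map_update_add' := by
        intro _ v i x y
        fin_cases i <;> simp
      map_update_smul' := by
        intro _ v i c x
        fin_cases i <;> simp
      map_eq_zero_of_eq' := by
        intro v i j hv hij
        have : v 0 = v 1 := by
          fin_cases i <;> fin_cases j <;> first | exact hv | exact hv.symm | exact absurd rfl hij
        rw [this, hf] }

lemma liftWedge_wedgeMk (f : L →ₗ[A] L →ₗ[A] N) (hf : ∀ X, f X X = 0) (X Y : L) :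
    liftWedge f hf (wedgeMk X Y) = f X Y := by
  simp [liftWedge, wedgeMk]

lemma wedge_induction {p : Multivector A L 2 → Prop} (hw : ∀ X Y, p (wedgeMk X Y)) (h0 : p 0)
    (ha : ∀ P Q, p P → p Q → p (P + Q)) (hs : ∀ (f : A) P, p P → p (f • P)) (P) : p P := by
  have hP : P ∈ Submodule.span A (Set.range (exteriorPower.ιMulti A 2 (M := L))) := by
    rw [exteriorPower.ιMulti_span]; trivial
  induction hP using Submodule.span_induction with
  | mem x hx =>
    obtain ⟨v, rfl⟩ := hx
    have : v = ![v 0, v 1] := by ext i; fin_cases i <;> rfl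
    rw [this]
    exact hw _ _
  | zero => exact h0
  | add x y _ _ hx hy => exact ha x y hx hy
  | smul a x _ hx => exact hs a x hx

end Bilinear

/-- The contraction `i(Λ)` of forms by a `2`-vector `Λ`, with
`(i(X ∧ Y) α)(Z_1, …, Z_k) = α(X, Y, Z_1, …, Z_k)`. -/
def contractBi : Multivector A L 2 →ₗ[A] Form A L (k + 2) →ₗ[A] Form A L k :=
  liftWedge
    (LinearMap.mk₂ A (fun X Y : L =>
        (AlternatingMap.curryLeftLinearMap.flip Y ∘ₗ AlternatingMap.curryLeftLinearMap.flip X :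
          Form A L (k + 2) →ₗ[A] Form A L k))
      (by intros; ext; simp)
      (by intros; ext; simp)
      (by intros; ext; simp)
      (by intros; ext; simp))
    (by
      intro X
      ext α v
      exact α.map_eq_zero_of_eq _ (i := 0) (j := 1) rfl (by simp))

lemma contractBi_wedgeMk (X Y : L) (α : Form A L (k + 2)) :
    contractBi (wedgeMk X Y) α = contract Y (contract X α) := by
  rw [contractBi, liftWedge_wedgeMk]; rfl

variable (R) in
/-- `i(Λ)` as an `R`-linear map. -/
def contractBiₗ (P : Multivector A L 2) : Form A L (k + 2) →ₗ[R] Form A L k where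
  toFun := contractBi P
  map_add' α β := map_add _ α β
  map_smul' r α := by
    have h (β : Form A L k) : r • β = algebraMap R A r • β := by ext; simp [Algebra.smul_def]
    have h' (β : Form A L (k + 2)) : r • β = algebraMap R A r • β := by
      ext; simp [Algebra.smul_def]
    rw [h', map_smul, ← h]; rfl

/-- `sharp α Λ` is `#_Λ(α)`, characterized by `β(#_Λ(α)) = Λ(α, β)`, where
`(X ∧ Y)(α, β) = α(X) β(Y) - α(Y) β(X)`. -/
def sharp (α : Module.Dual A L) : Multivector A L 2 →ₗ[A] L :=
  liftWedge
    (LinearMap.mk₂ A (fun X Y : L => α X • Y - α Y • X)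
      (by intros; simp only [map_add]; module)
      (by intros; simp only [map_smul, smul_eq_mul]; module)
      (by intros; simp only [map_add]; module)
      (by intros; simp only [map_smul, smul_eq_mul]; module))
    (by intro X; simp)

lemma sharp_wedgeMk (α : Module.Dual A L) (X Y : L) :
    sharp α (wedgeMk X Y) = α X • Y - α Y • X := by
  rw [sharp, liftWedge_wedgeMk]; rfl

lemma sharp_add (α β : Module.Dual A L) (P : Multivector A L 2) :
    sharp (α + β) P = sharp α P + sharp β P := by
  induction P using wedge_induction with
  | hw X Y => simp only [sharp_wedgeMk, LinearMap.add_apply]; module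
  | h0 => simp
  | ha P Q hP hQ => simp only [map_add, hP, hQ]; abel
  | hs f P hP => simp only [map_smul, hP, smul_add]

lemma sharp_smul (f : A) (α : Module.Dual A L) (P : Multivector A L 2) :
    sharp (f • α) P = f • sharp α P := by
  induction P using wedge_induction with
  | hw X Y => simp only [sharp_wedgeMk, LinearMap.smul_apply, smul_eq_mul]; module
  | h0 => simp
  | ha P Q hP hQ => simp only [map_add, hP, hQ, smul_add]
  | hs g P hP => simp only [map_smul, hP, smul_comm f g]

lemma apply_sharp_wedgeMk (α β : Module.Dual A L) (X Y : L) :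
    β (sharp α (wedgeMk X Y)) = α X * β Y - α Y * β X := by
  simp [sharp_wedgeMk]

variable (L) in
/-- The `1`-form `df`, as the `A`-linear functional `X ↦ X(f)`. -/
def differential (f : A) : Module.Dual A L where
  toFun X := ⁅X, f⁆
  map_add' X Y := add_lie X Y f
  map_smul' g X := by simp

lemma differential_apply (f : A) (X : L) : differential L f X = ⁅X, f⁆ := rfl

/-! ### First-order operators on `2`-vectors

An additive map `D` on `2`-vectors with `D(f P) = f D(P) + δ(f) P` is determined by its values on the
`X ∧ Y`. Such a `D` is obtained from the universal property of the exterior square, applied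
to the graph `P ↦ (P, D P)`, which is linear for a twisted module structure. -/
section FirstOrder
variable {N : Type*} [AddCommGroup N] [Module A N]

/-- `⋀^2 L × N` with scalar multiplication `f • (P, r) = (f P, f r + δ(f) P)`. -/
def Twisted (_ : Derivation ℤ A (Multivector A L 2 →ₗ[A] N)) : Type _ := Multivector A L 2 × N

namespace Twisted

/-- The pair `(P, r)`. -/
def mk (δ : Derivation ℤ A (Multivector A L 2 →ₗ[A] N)) (P : Multivector A L 2) (r : N) :
    Twisted δ := (P, r)

variable (δ : Derivation ℤ A (Multivector A L 2 →ₗ[A] N))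

instance : AddCommGroup (Twisted δ) := inferInstanceAs (AddCommGroup (Multivector A L 2 × N))

instance : Module A (Twisted δ) where
  smul f z := (f • z.1, f • z.2 + δ f z.1)
  one_smul z := Prod.ext (one_smul _ _) (by
    change (1 : A) • z.2 + δ 1 z.1 = z.2
    simp)
  mul_smul f g z := Prod.ext (mul_smul _ _ _) (by
    change (f * g) • z.2 + δ (f * g) z.1 = f • (g • z.2 + δ g z.1) + δ f (g • z.1)
    simp only [Derivation.leibniz, LinearMap.add_apply, LinearMap.smul_apply, map_smul]
    module)
  smul_zero f := Prod.ext (smul_zero _) (by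
    change f • (0 : N) + δ f 0 = 0
    simp)
  smul_add f z w := Prod.ext (smul_add _ _ _) (by
    change f • (z.2 + w.2) + δ f (z.1 + w.1) = (f • z.2 + δ f z.1) + (f • w.2 + δ f w.1)
    rw [map_add]; module)
  add_smul f g z := Prod.ext (add_smul _ _ _) (by
    change (f + g) • z.2 + δ (f + g) z.1 = (f • z.2 + δ f z.1) + (g • z.2 + δ g z.1)
    rw [map_add, LinearMap.add_apply]; module)
  zero_smul z := Prod.ext (zero_smul _ _) (by
    change (0 : A) • z.2 + δ 0 z.1 = 0
    simp)

lemma smul_snd (f : A) (z : Twisted δ) : (f • z).2 = f • z.2 + δ f z.1 := rfl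

end Twisted

/-- Compatibility of `h` and `δ` that makes `X ∧ Y ↦ h X Y` extend to a first-order operator
with `D(f P) = f D(P) + δ(f) P`. -/
structure FirstOrderData (δ : Derivation ℤ A (Multivector A L 2 →ₗ[A] N)) (h : L → L → N) :
    Prop where
  add_left : ∀ X Y Z, h (X + Y) Z = h X Z + h Y Z
  add_right : ∀ X Y Z, h X (Y + Z) = h X Y + h X Z
  self : ∀ X, h X X = 0
  smul_left : ∀ (f : A) X Y, h (f • X) Y = f • h X Y + δ f (wedgeMk X Y)

lemma wedgeMk_swap (X Y : L) : (wedgeMk X Y : Multivector A L 2) = - wedgeMk Y X := by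
  apply Subtype.ext
  rw [Submodule.coe_neg, coe_wedgeMk, coe_wedgeMk, eq_neg_iff_add_eq_zero]
  exact ExteriorAlgebra.ι_add_mul_swap X Y

lemma wedgeMk_add (X Y Z : L) :
    (wedgeMk (X + Y) Z : Multivector A L 2) = wedgeMk X Z + wedgeMk Y Z := by
  apply Subtype.ext
  simp [coe_wedgeMk, add_mul]

lemma wedgeMk_smul (f : A) (X Z : L) :
    (wedgeMk (f • X) Z : Multivector A L 2) = f • wedgeMk X Z := by
  apply Subtype.ext
  simp [coe_wedgeMk]

lemma wedgeMk_self (X : L) : (wedgeMk X X : Multivector A L 2) = 0 := by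
  apply Subtype.ext
  simp [coe_wedgeMk]

namespace FirstOrderData
variable {δ : Derivation ℤ A (Multivector A L 2 →ₗ[A] N)} {h : L → L → N}

lemma swap (H : FirstOrderData δ h) (X Y : L) : h X Y = - h Y X := by
  have := H.self (X + Y)
  rw [H.add_left, H.add_right, H.add_right, H.self, H.self, zero_add, add_zero] at this
  exact eq_neg_of_add_eq_zero_left this

/-- The graph `P ↦ (P, D P)`. -/
def toTwisted (H : FirstOrderData δ h) : Multivector A L 2 →ₗ[A] Twisted δ :=
  liftWedge
    (LinearMap.mk₂ A (fun X Y : L => Twisted.mk δ (wedgeMk X Y) (h X Y))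
      (fun X Y Z => Prod.ext (wedgeMk_add X Y Z) (H.add_left X Y Z))
      (fun f X Y => Prod.ext (wedgeMk_smul f X Y) (H.smul_left f X Y))
      (fun X Y Z => Prod.ext
        (by
          change wedgeMk X (Y + Z) = wedgeMk X Y + wedgeMk X Z
          rw [wedgeMk_swap, wedgeMk_add, wedgeMk_swap X Y, wedgeMk_swap X Z]; abel)
        (H.add_right X Y Z))
      (fun f X Y => Prod.ext
        (by
          change wedgeMk X (f • Y) = f • wedgeMk X Y
          rw [wedgeMk_swap, wedgeMk_smul, wedgeMk_swap X Y, smul_neg])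
        (by
          change h X (f • Y) = f • h X Y + δ f (wedgeMk X Y)
          rw [H.swap, H.smul_left, H.swap X Y, wedgeMk_swap X Y, map_neg]; module)))
    (fun X => Prod.ext (wedgeMk_self X) (H.self X))

lemma toTwisted_wedgeMk (H : FirstOrderData δ h) (X Y : L) :
    H.toTwisted (wedgeMk X Y) = Twisted.mk δ (wedgeMk X Y) (h X Y) :=
  liftWedge_wedgeMk _ _ X Y

lemma toTwisted_fst (H : FirstOrderData δ h) (P : Multivector A L 2) : (H.toTwisted P).1 = P := by
  induction P using wedge_induction with
  | hw X Y => rw [toTwisted_wedgeMk]; rfl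
  | h0 => rw [map_zero]; rfl
  | ha P Q hP hQ =>
    rw [map_add]
    exact congrArg₂ (· + ·) hP hQ
  | hs f P hP =>
    rw [map_smul]
    exact congrArg (f • ·) hP

/-- The operator `D` with `D(X ∧ Y) = h X Y` and `D(f P) = f D(P) + δ(f) P`. -/
def lift (H : FirstOrderData δ h) : Multivector A L 2 →+ N where
  toFun P := (H.toTwisted P).2
  map_zero' := by rw [map_zero]; rfl
  map_add' P Q := by rw [map_add]; rfl

lemma lift_wedgeMk (H : FirstOrderData δ h) (X Y : L) : H.lift (wedgeMk X Y) = h X Y := by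
  change (H.toTwisted (wedgeMk X Y)).2 = _
  rw [toTwisted_wedgeMk]; rfl

lemma lift_smul (H : FirstOrderData δ h) (f : A) (P : Multivector A L 2) :
    H.lift (f • P) = f • H.lift P + δ f P := by
  change (H.toTwisted (f • P)).2 = _
  rw [map_smul, Twisted.smul_snd, toTwisted_fst]; rfl

end FirstOrderData
end FirstOrder

/-! ### The Schouten-Nijenhuis brackets -/

section Schouten

variable (L) in
/-- `f ↦ df` as a derivation. -/
def differentialDer : Derivation ℤ A (Module.Dual A L) :=
  Derivation.mk' (AddMonoidHom.toIntLinearMap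
    { toFun := differential L
      map_zero' := by ext X; simp [differential_apply]
      map_add' f g := by ext X; simp [differential_apply] })
    (fun f g => by
      ext X
      change ⁅X, f * g⁆ = f * ⁅X, g⁆ + g * ⁅X, f⁆
      rw [LieRinehartRing.leibniz_mul_right, smul_eq_mul]; ring)

/-- `f ↦ (P ↦ X(f) P)`. -/
def lieSymbol (X : L) : Derivation ℤ A (Multivector A L 2 →ₗ[A] ExteriorAlgebra A L) :=
  (LinearMap.toSpanSingleton A (Multivector A L 2 →ₗ[A] ExteriorAlgebra A L) (Submodule.subtype _) ∘ₗ
    Module.Dual.eval A L X).compDer (differentialDer L)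

lemma lieSymbol_apply (X : L) (f : A) (P : Multivector A L 2) :
    lieSymbol X f P = ⁅X, f⁆ • (P : ExteriorAlgebra A L) := rfl

lemma lieData (X : L) : FirstOrderData (lieSymbol (A := A) X)
    (fun Y Z => ExteriorAlgebra.ι A ⁅X, Y⁆ * ExteriorAlgebra.ι A Z + ExteriorAlgebra.ι A Y * ExteriorAlgebra.ι A ⁅X, Z⁆) where
  add_left Y Z W := by simp only [lie_add, map_add, add_mul]; abel
  add_right Y Z W := by simp only [lie_add, map_add, mul_add]; abel
  self Y := ExteriorAlgebra.ι_add_mul_swap _ _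
  smul_left f Y Z := by
    simp only [LieRinehartRing.leibniz_smul_right, map_add, map_smul, add_mul, smul_mul_assoc,
      lieSymbol_apply, coe_wedgeMk]
    module

/-- The Lie derivative `L_X P = [X, P]` of a `2`-vector `P`, characterized by
`L_X (Y ∧ Z) = [X, Y] ∧ Z + Y ∧ [X, Z]` and `L_X (f P) = f L_X P + X(f) P`
(see `lieBi_wedgeMk` and `lieBi_smul`). Its values are `2`-vectors, viewed in the exterior algebra. -/
def lieBi (X : L) : Multivector A L 2 →+ ExteriorAlgebra A L := (lieData X).lift

lemma lieBi_wedgeMk (X Y Z : L) :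
    lieBi X (wedgeMk Y Z : Multivector A L 2) = ExteriorAlgebra.ι A ⁅X, Y⁆ * ExteriorAlgebra.ι A Z + ExteriorAlgebra.ι A Y * ExteriorAlgebra.ι A ⁅X, Z⁆ :=
  (lieData X).lift_wedgeMk Y Z

lemma lieBi_smul (X : L) (f : A) (Q : Multivector A L 2) :
    lieBi X (f • Q) = f • lieBi X Q + ⁅X, f⁆ • (Q : ExteriorAlgebra A L) :=
  (lieData X).lift_smul f Q

lemma lieBi_add_left (X Y : L) (Q : Multivector A L 2) :
    lieBi (X + Y) Q = lieBi X Q + lieBi Y Q := by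
  induction Q using wedge_induction with
  | hw Z W => simp only [lieBi_wedgeMk, add_lie, map_add, add_mul, mul_add]; abel
  | h0 => simp
  | ha P Q hP hQ => simp only [map_add, hP, hQ]; abel
  | hs f P hP => simp only [lieBi_smul, hP, add_lie]; module

lemma lieBi_smul_left (f : A) (X : L) (Q : Multivector A L 2) :
    lieBi (f • X) Q = f • lieBi X Q - ExteriorAlgebra.ι A X * ExteriorAlgebra.ι A (sharp (differential L f) Q) := by
  induction Q using wedge_induction with
  | hw Z W =>
    simp only [lieBi_wedgeMk, smul_lie_eq, map_sub, map_smul, sub_mul, mul_sub, sharp_wedgeMk,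
      differential_apply, smul_mul_assoc, mul_smul_comm]
    have : ExteriorAlgebra.ι A Z * ExteriorAlgebra.ι A X = - (ExteriorAlgebra.ι A X * ExteriorAlgebra.ι A Z) := eq_neg_of_add_eq_zero_left (ExteriorAlgebra.ι_add_mul_swap Z X)
    rw [this]
    module
  | h0 => simp
  | ha P Q hP hQ => simp only [map_add, hP, hQ, mul_add]; module
  | hs g P hP =>
    simp only [lieBi_smul, hP, map_smul, mul_smul_comm, LieRinehartRing.lie_smul_eq_mul]; module

/-- `f ↦ (P ↦ P ∧ i_{df} Q)`, where `i_{df} Q = #_Q(df)`. -/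
def schoutenSymbol (Q : Multivector A L 2) : Derivation ℤ A (Multivector A L 2 →ₗ[A] ExteriorAlgebra A L) :=
  (({ toFun := fun α => (LinearMap.mulRight A (ExteriorAlgebra.ι A (sharp α Q))) ∘ₗ Submodule.subtype _
      map_add' := fun α β => by
        ext P
        simp [sharp_add, mul_add]
      map_smul' := fun f α => by
        ext P
        simp [sharp_smul] } : Module.Dual A L →ₗ[A] Multivector A L 2 →ₗ[A] ExteriorAlgebra A L)).compDer
    (differentialDer L)

lemma schoutenSymbol_apply (Q : Multivector A L 2) (f : A) (P : Multivector A L 2) :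
    schoutenSymbol Q f P = (P : ExteriorAlgebra A L) * ExteriorAlgebra.ι A (sharp (differential L f) Q) := rfl

lemma schoutenData (Q : Multivector A L 2) : FirstOrderData (schoutenSymbol Q)
    (fun X Y => ExteriorAlgebra.ι A Y * lieBi X Q - ExteriorAlgebra.ι A X * lieBi Y Q) where
  add_left X Y Z := by simp only [lieBi_add_left, map_add, add_mul, mul_add]; abel
  add_right X Y Z := by simp only [lieBi_add_left, map_add, add_mul, mul_add]; abel
  self X := sub_self _
  smul_left f X Y := by
    have : ExteriorAlgebra.ι A X * ExteriorAlgebra.ι A Y = - (ExteriorAlgebra.ι A Y * ExteriorAlgebra.ι A X) := eq_neg_of_add_eq_zero_left (ExteriorAlgebra.ι_add_mul_swap X Y)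
    simp only [lieBi_smul_left, map_smul, smul_mul_assoc, mul_sub, mul_smul_comm,
      schoutenSymbol_apply, coe_wedgeMk, ← mul_assoc, this, neg_mul]
    module

/-- The Schouten-Nijenhuis bracket `[P, Q]` of two `2`-vectors (a `3`-vector, viewed in the exterior
algebra). The sign convention is
`[X_1 ∧ ⋯ ∧ X_p, Q] = ∑_i (-1)^{i+1} X_1 ∧ ⋯ ∧ X̂_i ∧ ⋯ ∧ X_p ∧ [X_i, Q]`, so for `p = 2`
`[X ∧ Y, Q] = Y ∧ [X, Q] - X ∧ [Y, Q]`, and `[f P, Q] = f [P, Q] + P ∧ i_{df} Q`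
(see `schouten_wedgeMk` and `schouten_smul`). With this convention a contact form gives a pair with
`[Λ, Λ] = 2 E ∧ Λ`. -/
def schouten (P Q : Multivector A L 2) : ExteriorAlgebra A L := (schoutenData Q).lift P

lemma schouten_wedgeMk (X Y : L) (Q : Multivector A L 2) :
    schouten (wedgeMk X Y) Q = ExteriorAlgebra.ι A Y * lieBi X Q - ExteriorAlgebra.ι A X * lieBi Y Q :=
  (schoutenData Q).lift_wedgeMk X Y

lemma schouten_smul (f : A) (P Q : Multivector A L 2) :
    schouten (f • P) Q =
      f • schouten P Q + (P : ExteriorAlgebra A L) * ExteriorAlgebra.ι A (sharp (differential L f) Q) :=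
  (schoutenData Q).lift_smul f P

/-- `(Λ, E)` is a Jacobi structure: `[Λ, Λ] = 2 E ∧ Λ` and `L_E Λ = [E, Λ] = 0`. -/
structure IsJacobi (Λ : Multivector A L 2) (E : L) : Prop where
  schouten_self : schouten Λ Λ =
    (2 : A) • (ExteriorAlgebra.ι A E * (Λ : ExteriorAlgebra A L))
  lie_eq_zero : lieBi E Λ = 0

end Schouten

end Forms

/-! ### The Lichnerowicz-Jacobi complex -/

section Homology

section Chains
universe u v w
variable (R : Type u) (A : Type v) (L : Type w) [CommRing R] [CommRing A] [LieRing L] [Module A L] [Algebra R A]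

/-- `Ω^{k-1}`, with `Ω^{-1} = 0`. -/
def LowerForm : ℕ → Type (max w v)
  | 0 => PUnit.{max w v + 1}
  | k + 1 => Form A L k

instance : ∀ k, AddCommGroup (LowerForm A L k)
  | 0 => (inferInstance : AddCommGroup PUnit.{max w v + 1})
  | k + 1 => (inferInstance : AddCommGroup (Form A L k))

instance : ∀ k, Module R (LowerForm A L k)
  | 0 => (inferInstance : Module R PUnit.{max w v + 1})
  | k + 1 => (inferInstance : Module R (Form A L k))

/-- The identification `Ω^{(k+1)-1} = Ω^k`. -/
def lowerEquiv (k : ℕ) : LowerForm A L (k + 1) ≃ₗ[R] Form A L k :=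
  LinearEquiv.refl R (Form A L k)

/-- The `k`-chains `Ω^k ⊕ Ω^{k-1}`. -/
def LJChain (k : ℕ) : Type _ := Form A L k × LowerForm A L k

instance (k : ℕ) : AddCommGroup (LJChain A L k) :=
  inferInstanceAs (AddCommGroup (Form A L k × LowerForm A L k))

instance (k : ℕ) : Module R (LJChain A L k) :=
  inferInstanceAs (Module R (Form A L k × LowerForm A L k))

/-- The pair description of a chain. -/
def LJChain.equiv (k : ℕ) : LJChain A L k ≃ₗ[R] Form A L k × LowerForm A L k :=
  LinearEquiv.refl R (Form A L k × LowerForm A L k)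

end Chains

variable (R : Type*) {A L : Type*} [CommRing R] [CommRing A] [LieRing L] [Module A L]
  [LieRingModule L A] [LieRinehartRing A L] [Algebra R A] [LieAlgebra R L]
  [LieRinehartAlgebra R A L]

/-- `α ↦ i(Λ) dα - d i(Λ) α` on forms of positive degree (`i(Λ) α = 0` if `α` has degree `1`). -/
def bracketD (Λ : Multivector A L 2) : ∀ k, Form A L (k + 1) →ₗ[R] Form A L k
  | 0 => contractBiₗ R Λ ∘ₗ extDₗ R
  | _ + 1 => contractBiₗ R Λ ∘ₗ extDₗ R - extDₗ R ∘ₗ contractBiₗ R Λ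

/-- First component of `δ(α, β)`, with `r = k + 1`:
`i(Λ) dα - d i(Λ) α + r i_E α + (-1)^r L_E β`. -/
def boundaryFst (Λ : Multivector A L 2) (E : L) (k : ℕ) :
    Form A L (k + 1) × LowerForm A L (k + 1) →ₗ[R] Form A L k :=
  (bracketD R Λ k + ((k + 1 : ℕ) : R) • contractₗ R E) ∘ₗ LinearMap.fst R _ _ +
    (-1 : R) ^ (k + 1) •
      (lieDerivₗ R E ∘ₗ (lowerEquiv R A L k).toLinearMap ∘ₗ LinearMap.snd R _ _)

/-- Second component of `δ(α, β)`, with `r = k + 1`: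
`i(Λ) dβ - d i(Λ) β + (r - 1) i_E β + (-1)^r i(Λ) α`; it lies in `Ω^{-1} = 0` if `r = 1`. -/
def boundarySnd (Λ : Multivector A L 2) (E : L) :
    ∀ k, Form A L (k + 1) × LowerForm A L (k + 1) →ₗ[R] LowerForm A L k
  | 0 => 0
  | k + 1 => (lowerEquiv R A L k).symm.toLinearMap ∘ₗ
      ((bracketD R Λ k + ((k + 1 : ℕ) : R) • contractₗ R E) ∘ₗ
          (lowerEquiv R A L (k + 1)).toLinearMap ∘ₗ LinearMap.snd R _ _ +
        (-1 : R) ^ (k + 2) • (contractBiₗ R Λ ∘ₗ LinearMap.fst R _ _))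

/-- The LJ-homology operator `δ : Ω^{k+1} ⊕ Ω^k → Ω^k ⊕ Ω^{k-1}`. -/
def boundary (Λ : Multivector A L 2) (E : L) (k : ℕ) :
    LJChain A L (k + 1) →ₗ[R] LJChain A L k :=
  (LJChain.equiv R A L k).symm.toLinearMap ∘ₗ
    (boundaryFst R Λ E k).prod (boundarySnd R Λ E k) ∘ₗ
      (LJChain.equiv R A L (k + 1)).toLinearMap

/-- `δ(α, f) = (i(Λ) dα + i_E α - L_E f, 0)` for a `1`-form `α` and a function `f`. -/
lemma boundary_zero_apply (Λ : Multivector A L 2) (E : L) (α : Form A L 1) (f : Form A L 0) :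
    LJChain.equiv R A L 0
        (boundary R Λ E 0 ((LJChain.equiv R A L 1).symm (α, (lowerEquiv R A L 0).symm f))) =
      (contractBi Λ (extD α) + contract E α - lieDeriv E f, 0) := by
  refine Prod.ext ?_ rfl
  change (contractBi Λ (extD α) + ((0 + 1 : ℕ) : R) • contract E α) +
    (-1 : R) ^ (0 + 1) • lieDeriv E f = _
  ext v
  simp [sub_eq_add_neg]

/-- The formula for `δ(α, β)` with `α` of degree `r = k + 3` and `β` of degree `r - 1 = k + 2`. -/
lemma boundary_apply (Λ : Multivector A L 2) (E : L) (k : ℕ) (α : Form A L (k + 3))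
    (β : Form A L (k + 2)) :
    LJChain.equiv R A L (k + 2)
        (boundary R Λ E (k + 2)
          ((LJChain.equiv R A L (k + 3)).symm (α, (lowerEquiv R A L (k + 2)).symm β))) =
      (contractBi Λ (extD α) - extD (contractBi Λ α) + ((k + 3 : ℕ) : R) • contract E α +
          (-1 : R) ^ (k + 3) • lieDeriv E β,
        (lowerEquiv R A L (k + 1)).symm
          (contractBi Λ (extD β) - extD (contractBi Λ β) + ((k + 2 : ℕ) : R) • contract E β +
            (-1 : R) ^ (k + 3) • contractBi Λ α)) := rfl

/-- The `k`-cycles: all `0`-chains, and the kernel of `δ` in positive degree. -/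
def cycles (Λ : Multivector A L 2) (E : L) : ∀ k, Submodule R (LJChain A L k)
  | 0 => ⊤
  | k + 1 => LinearMap.ker (boundary R Λ E k)

/-- The LJ-homology `H_k = ker δ / im δ` in degree `k`. The image is taken inside the kernel; for
a Jacobi structure `δ ∘ δ = 0`, so the whole image lies there. -/
abbrev LJHomology (Λ : Multivector A L 2) (E : L) (k : ℕ) : Type _ :=
  cycles R Λ E k ⧸ (LinearMap.range (boundary R Λ E k)).submoduleOf (cycles R Λ E k)

end Homology

end LJ

end

noncomputable section

namespace LJ
open Function

/-! ### Cartan calculus of `contract`, `lieDeriv` and `extD` in a Lie-Rinehart algebra. -/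

section Cartan
variable {A L : Type*} [CommRing A] [LieRing L] [Module A L] [LieRingModule L A]
  [LieRinehartRing A L] {k : ℕ}

/-! The two complexes are isomorphic, not merely their homologies. In degree `r` the isomorphism
sends `(α, β)` to `(a^r α + (-1)^{r+1} a^{r-1} da ∧ β, a^r β)`. It is invertible because `a` is a
unit of the ring of functions, and it carries the boundary of the conformal change to the original
boundary (`conformalEquiv_boundary`).

The powers of `a` are forced. The operator `D = i(Λ)d - d i(Λ)` is of first order with symbol
`i_{#df}` (`bracketD_smul`), so `D(a^r α)` produces `r a^{r-1} i_{#da} α`. This is what the new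
vector field `#_Λ(da) + aE` contributes through the term `r i_{E_a} α`. Replacing `Λ` by `aΛ` turns
`D` into `aD - da ∧ i(Λ)` (`smul_bracketD_succ`). The correction `da ∧ i(Λ)α` is absorbed by the
off-diagonal term `da ∧ β` of the isomorphism, applied to the summand `i(Λ)α` of the second
component. The same off-diagonal term accounts for `L_{#da} β`, through `D(da ∧ β) = -L_{#da} β - da
∧ Dβ` (`bracketD_wedgeD_succ`).

All of this is formal Cartan calculus, and so is carried out over any Lie-Rinehart algebra. Geometry
enters only at the end: a positive smooth function is invertible. Most of the differential-form
identities are proved by induction on the degree, since a form of positive degree is determined by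
its contractions (`form_ext`). Those involving `Λ` reduce to decomposable bivectors by linearity. -/

lemma form_ext {α β : Form A L (k + 1)} (h : ∀ X, contract X α = contract X β) : α = β := by
  ext v
  have := DFunLike.congr_fun (h (v 0)) (Fin.tail v)
  simpa only [contract_apply, Fin.cons_self_tail] using this

lemma contract_add (X : L) (α β : Form A L (k + 1)) :
    contract X (α + β) = contract X α + contract X β := rfl

lemma contract_sub (X : L) (α β : Form A L (k + 1)) :
    contract X (α - β) = contract X α - contract X β := rfl

lemma contract_smul (X : L) (f : A) (α : Form A L (k + 1)) :
    contract X (f • α) = f • contract X α := rfl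

lemma contract_zero (X : L) : contract X (0 : Form A L (k + 1)) = 0 := rfl

lemma add_contract (X Y : L) (α : Form A L (k + 1)) :
    contract (X + Y) α = contract X α + contract Y α := by
  simp [contract]

lemma sub_contract (X Y : L) (α : Form A L (k + 1)) :
    contract (X - Y) α = contract X α - contract Y α := by
  simp [contract]

lemma smul_contract (f : A) (X : L) (α : Form A L (k + 1)) :
    contract (f • X) α = f • contract X α := by
  simp [contract]

lemma zero_contract (α : Form A L (k + 1)) : contract (0 : L) α = 0 := by
  simp [contract]

lemma extD_add (α β : Form A L k) : extD (α + β) = extD α + extD β := by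
  ext v; exact koszul_add α β v

lemma extD_zero : extD (0 : Form A L k) = 0 := by
  have := extD_add (0 : Form A L k) 0
  simpa using this

lemma extD_neg (α : Form A L k) : extD (-α) = -extD α := by
  have := extD_add α (-α)
  rw [add_neg_cancel, extD_zero] at this
  exact (neg_eq_of_add_eq_zero_right this.symm).symm

lemma extD_sub (α β : Form A L k) : extD (α - β) = extD α - extD β := by
  rw [sub_eq_add_neg, extD_add, extD_neg, sub_eq_add_neg]

lemma lieDeriv_add (X : L) (α β : Form A L k) :
    lieDeriv X (α + β) = lieDeriv X α + lieDeriv X β := by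
  ext v
  simp only [lieDeriv_apply, AlternatingMap.add_apply, lie_add, Finset.sum_add_distrib]
  ring

lemma lieDeriv_zero (X : L) : lieDeriv X (0 : Form A L k) = 0 := by
  have := lieDeriv_add X (0 : Form A L k) 0
  simpa using this

lemma lieDeriv_neg (X : L) (α : Form A L k) : lieDeriv X (-α) = -lieDeriv X α := by
  have := lieDeriv_add X α (-α)
  rw [add_neg_cancel, lieDeriv_zero] at this
  exact (neg_eq_of_add_eq_zero_right this.symm).symm

lemma lieDeriv_sub (X : L) (α β : Form A L k) :
    lieDeriv X (α - β) = lieDeriv X α - lieDeriv X β := by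
  rw [sub_eq_add_neg, lieDeriv_add, lieDeriv_neg, sub_eq_add_neg]

lemma add_lieDeriv (X Y : L) (α : Form A L k) :
    lieDeriv (X + Y) α = lieDeriv X α + lieDeriv Y α := by
  ext v
  simp only [lieDeriv_apply, AlternatingMap.add_apply, add_lie, α.map_update_add,
    Finset.sum_add_distrib]
  ring

lemma lieDeriv_smul (X : L) (f : A) (α : Form A L k) :
    lieDeriv X (f • α) = f • lieDeriv X α + ⁅X, f⁆ • α := by
  ext v
  simp only [lieDeriv_apply, AlternatingMap.add_apply, AlternatingMap.smul_apply, smul_eq_mul,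
    LieRinehartRing.leibniz_mul_right, ← Finset.mul_sum]
  ring

lemma lieDeriv_zero_form (X : L) (α : Form A L 0) (v : Fin 0 → L) :
    lieDeriv X α v = ⁅X, α v⁆ := by
  simp [lieDeriv_apply]

/-- Cartan's formula `i_X d = L_X - d i_X`. -/
lemma contract_extD (X : L) (α : Form A L (k + 1)) :
    contract X (extD α) = lieDeriv X α - extD (contract X α) := by
  ext v; exact koszul_cons α X v

/-- The degree-zero case of Cartan's formula, where the term `d i_X` is absent. It is separate
because `contract` has no value on forms of degree `0`; the later `_zero_form` and `_one_form`
variants exist for the same reason. -/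
lemma contract_extD_zero_form (X : L) (α : Form A L 0) :
    contract X (extD α) = lieDeriv X α := by
  ext v
  change koszul α (Fin.cons X v) = _
  rw [koszul_zero, lieDeriv_zero_form, Subsingleton.elim v ![]]
  rfl

/-- `i_Y L_X = L_X i_Y - i_{[X, Y]}`. -/
lemma contract_lieDeriv (X Y : L) (α : Form A L (k + 1)) :
    contract Y (lieDeriv X α) = lieDeriv X (contract Y α) - contract ⁅X, Y⁆ α := by
  ext v
  simp only [contract_apply, lieDeriv_apply, AlternatingMap.sub_apply, Fin.sum_univ_succ,
    Fin.cons_zero, Fin.cons_succ, Fin.update_cons_zero, ← Fin.cons_update]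
  ring

lemma lieDeriv_lie (X Y : L) : ∀ {k : ℕ} (α : Form A L k),
    lieDeriv ⁅X, Y⁆ α = lieDeriv X (lieDeriv Y α) - lieDeriv Y (lieDeriv X α)
  | 0, α => by
    ext v
    simp only [AlternatingMap.sub_apply, lieDeriv_zero_form, lie_lie]
  | k + 1, α => by
    refine form_ext fun Z => ?_
    simp only [contract_sub, contract_lieDeriv, lieDeriv_lie X Y (contract Z α), lieDeriv_sub,
      lie_lie X Y Z, sub_contract]
    abel

/-- Contracting with `Y` reduces the claim, by Cartan's formula and the commutator `[L_X, i_Y] =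
i_{[X, Y]}`, to `L_{[X, Y]} = [L_X, L_Y]` on `α` and to the claim for `i_Y α`. -/
lemma lieDeriv_extD (X : L) : ∀ {k : ℕ} (α : Form A L k),
    lieDeriv X (extD α) = extD (lieDeriv X α)
  | 0, α => by
    refine form_ext fun Y => ?_
    simp only [contract_lieDeriv, contract_extD_zero_form, lieDeriv_lie]
    abel
  | k + 1, α => by
    refine form_ext fun Y => ?_
    simp only [contract_lieDeriv, contract_extD, lieDeriv_lie, lieDeriv_sub, extD_sub,
      lieDeriv_extD X (contract Y α)]
    abel

/-- Since `d` commutes with `L_X`, Cartan's formula gives `i_X d d α = d d i_X α`, and the degree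
drops. -/
lemma extD_extD : ∀ {k : ℕ} (α : Form A L k), extD (extD α) = 0
  | 0, α => by
    refine form_ext fun X => ?_
    simp only [contract_extD, contract_extD_zero_form, lieDeriv_extD, contract_zero, sub_self]
  | k + 1, α => by
    refine form_ext fun X => ?_
    simp only [contract_extD, lieDeriv_extD, extD_sub, extD_extD (contract X α), contract_zero,
      sub_zero, sub_self]

/-! ### The exterior product with an exact `1`-form -/

/-- `β ↦ df ∧ β`. -/
def wedgeD (f : A) (β : Form A L k) : Form A L (k + 1) := extD (f • β) - f • extD β

/-- The derivatives of `β` cancel in `d(fβ) - f dβ`. The resulting formula shows that the operation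
is tensorial in `β`, which `wedgeD_smul` uses. -/
lemma wedgeD_apply (f : A) (β : Form A L k) (v : Fin (k + 1) → L) :
    wedgeD f β v = ∑ i : Fin (k + 1), (-1) ^ (i : ℕ) * (⁅v i, f⁆ * β (i.removeNth v)) := by
  change koszul (f • β) v - f * koszul β v = _
  rw [koszul_smul]; ring

lemma extD_smul (f : A) (β : Form A L k) : extD (f • β) = f • extD β + wedgeD f β := by
  rw [wedgeD]; abel

lemma wedgeD_add (f : A) (α β : Form A L k) : wedgeD f (α + β) = wedgeD f α + wedgeD f β := by
  simp only [wedgeD, smul_add, extD_add]; abel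

lemma wedgeD_smul (f g : A) (β : Form A L k) : wedgeD f (g • β) = g • wedgeD f β := by
  ext v
  simp only [wedgeD_apply, AlternatingMap.smul_apply, smul_eq_mul, Finset.mul_sum]
  exact Finset.sum_congr rfl fun i _ => by ring

lemma wedgeD_neg (f : A) (β : Form A L k) : wedgeD f (-β) = -wedgeD f β := by
  ext v
  simp [wedgeD_apply]

lemma wedgeD_sub (f : A) (α β : Form A L k) : wedgeD f (α - β) = wedgeD f α - wedgeD f β := by
  rw [sub_eq_add_neg, wedgeD_add, wedgeD_neg, sub_eq_add_neg]

lemma lie_pow (X : L) (f : A) (m : ℕ) : ⁅X, f ^ (m + 1)⁆ = (m + 1 : A) * f ^ m * ⁅X, f⁆ := by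
  induction m with
  | zero => simp
  | succ m ih =>
    rw [pow_succ, LieRinehartRing.leibniz_mul_right, ih, smul_eq_mul]
    push_cast
    ring

/-- Follows from `d² = 0` alone, because `df ∧ β` is defined as a commutator of `d` with
multiplication by `f`. -/
lemma extD_wedgeD (f : A) (β : Form A L k) : extD (wedgeD f β) = -wedgeD f (extD β) := by
  rw [wedgeD, extD_sub, extD_extD, extD_smul, extD_extD]; simp

lemma contract_wedgeD (X : L) (f : A) (β : Form A L (k + 1)) :
    contract X (wedgeD f β) = ⁅X, f⁆ • β - wedgeD f (contract X β) := by
  simp only [wedgeD, contract_sub, contract_smul, contract_extD, lieDeriv_smul, smul_sub]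
  abel

lemma contract_wedgeD_zero_form (X : L) (f : A) (β : Form A L 0) :
    contract X (wedgeD f β) = ⁅X, f⁆ • β := by
  simp only [wedgeD, contract_sub, contract_smul, contract_extD_zero_form, lieDeriv_smul]
  abel

lemma wedgeD_wedgeD (f : A) : ∀ {k : ℕ} (β : Form A L k), wedgeD f (wedgeD f β) = 0
  | 0, β => by
    refine form_ext fun X => ?_
    simp only [contract_wedgeD, contract_wedgeD_zero_form, wedgeD_smul, contract_zero, sub_self]
  | k + 1, β => by
    refine form_ext fun X => ?_
    simp only [contract_wedgeD, wedgeD_sub, wedgeD_smul, wedgeD_wedgeD f (contract X β),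
      contract_zero, sub_zero, sub_self]

/-- `L_{f X} = f L_X + df ∧ i_X`. -/
lemma smul_lieDeriv (f : A) (X : L) (β : Form A L (k + 1)) :
    lieDeriv (f • X) β = f • lieDeriv X β + wedgeD f (contract X β) := by
  have h (Y : L) : lieDeriv Y β = contract Y (extD β) + extD (contract Y β) := by
    rw [contract_extD]; abel
  rw [h, h, smul_contract, smul_contract, extD_smul, smul_add]; abel

lemma smul_lieDeriv_zero_form (f : A) (X : L) (β : Form A L 0) :
    lieDeriv (f • X) β = f • lieDeriv X β := by
  rw [← contract_extD_zero_form, smul_contract, contract_extD_zero_form]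

/-! ### Contraction with a `2`-vector -/

/-- For `Λ = X ∧ Y`, moving both contractions past `df` leaves `X(f) i_Y β - Y(f) i_X β`, which is
contraction with `#_Λ(df)`. Both sides are linear in `Λ`. -/
lemma contractBi_wedgeD (Λ : Multivector A L 2) (f : A) (β : Form A L (k + 2)) :
    contractBi Λ (wedgeD f β) =
      wedgeD f (contractBi Λ β) + contract (sharp (differential L f) Λ) β := by
  induction Λ using wedge_induction with
  | hw X Y =>
    simp only [contractBi_wedgeMk, contract_wedgeD, contract_sub, contract_smul, sharp_wedgeMk,
      differential_apply, sub_contract, smul_contract]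
    abel
  | h0 => simp [zero_contract, wedgeD, extD_zero]
  | ha P Q hP hQ =>
    simp only [map_add, LinearMap.add_apply, hP, hQ, wedgeD_add, add_contract]; abel
  | hs g P hP =>
    simp only [map_smul, LinearMap.smul_apply, hP, wedgeD_smul, smul_contract, smul_add]

lemma contractBi_wedgeD_one_form (Λ : Multivector A L 2) (f : A) (β : Form A L 1) :
    contractBi Λ (wedgeD f β) = contract (sharp (differential L f) Λ) β := by
  induction Λ using wedge_induction with
  | hw X Y =>
    simp only [contractBi_wedgeMk, contract_wedgeD, contract_wedgeD_zero_form, contract_sub,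
      contract_smul, sharp_wedgeMk, differential_apply, sub_contract, smul_contract]
  | h0 => simp [zero_contract]
  | ha P Q hP hQ => simp only [map_add, LinearMap.add_apply, hP, hQ, add_contract]
  | hs g P hP => simp only [map_smul, LinearMap.smul_apply, hP, smul_contract]

/-- Skew-symmetry: the left side is `Λ(df, df)`. -/
lemma sharp_differential_lie_self (Λ : Multivector A L 2) (f : A) :
    ⁅sharp (differential L f) Λ, f⁆ = 0 := by
  rw [← differential_apply]
  induction Λ using wedge_induction with
  | hw X Y => rw [apply_sharp_wedgeMk]; ring
  | h0 => simp
  | ha P Q hP hQ => rw [map_add, map_add, hP, hQ, add_zero]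
  | hs g P hP => rw [map_smul, map_smul, hP, smul_zero]

end Cartan

/-! ### The operator `i(Λ)d - d i(Λ)` and the boundary. -/

section Complex
variable {R A L : Type*} [CommRing R] [CommRing A] [LieRing L] [Module A L]
  [LieRingModule L A] [LieRinehartRing A L] [Algebra R A] [LieAlgebra R L]
  [LieRinehartAlgebra R A L] {k : ℕ}

/-- Turns the numerical coefficients of the boundary into elements of `A`, so that the conformal
identities can be checked by `module` over the single ring `A`. -/
lemma Form.scalar_smul (r : R) (α : Form A L k) : r • α = algebraMap R A r • α := by
  ext v; simp [Algebra.smul_def]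

lemma bracketD_zero (Λ : Multivector A L 2) (α : Form A L 1) :
    bracketD R Λ 0 α = contractBi Λ (extD α) := rfl

lemma bracketD_succ (Λ : Multivector A L 2) (α : Form A L (k + 2)) :
    bracketD R Λ (k + 1) α = contractBi Λ (extD α) - extD (contractBi Λ α) := rfl

/-- As `i(Λ)` is `A`-linear, the defect from linearity is the commutator of `i(Λ)` with `df ∧ ·`,
computed in `contractBi_wedgeD`. -/
lemma bracketD_smul (Λ : Multivector A L 2) (f : A) : ∀ {k : ℕ} (α : Form A L (k + 1)),
    bracketD R Λ k (f • α) =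
      f • bracketD R Λ k α + contract (sharp (differential L f) Λ) α
  | 0, α => by
    simp only [bracketD_zero, extD_smul, map_add, map_smul, contractBi_wedgeD_one_form]
  | k + 1, α => by
    simp only [bracketD_succ, extD_smul, map_add, map_smul, contractBi_wedgeD, smul_sub]
    abel

lemma sharp_differential_pow (Λ : Multivector A L 2) (f : A) (m : ℕ) :
    sharp (differential L (f ^ (m + 1))) Λ =
      ((m + 1 : A) * f ^ m) • sharp (differential L f) Λ := by
  have h : differential L (f ^ (m + 1)) = ((m + 1 : A) * f ^ m) • differential L f := by
    ext X
    simp [differential_apply, lie_pow]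
  rw [h, sharp_smul]

lemma smul_bracketD_zero (Λ : Multivector A L 2) (f : A) (α : Form A L 1) :
    bracketD R (f • Λ) 0 α = f • bracketD R Λ 0 α := by
  simp only [bracketD_zero, map_smul, LinearMap.smul_apply]

lemma smul_bracketD_succ (Λ : Multivector A L 2) (f : A) (α : Form A L (k + 2)) :
    bracketD R (f • Λ) (k + 1) α =
      f • bracketD R Λ (k + 1) α - wedgeD f (contractBi Λ α) := by
  simp only [bracketD_succ, map_smul, LinearMap.smul_apply, extD_smul, smul_sub]
  abel

/-- The correction term in `smul_bracketD_succ` is a multiple of `df`, hence killed by `df ∧ df =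
0`. -/
lemma wedgeD_smul_bracketD (Λ : Multivector A L 2) (f : A) : ∀ {k : ℕ} (α : Form A L (k + 1)),
    wedgeD f (bracketD R (f • Λ) k α) = f • wedgeD f (bracketD R Λ k α)
  | 0, α => by rw [smul_bracketD_zero, wedgeD_smul]
  | k + 1, α => by rw [smul_bracketD_succ, wedgeD_sub, wedgeD_smul, wedgeD_wedgeD, sub_zero]

lemma bracketD_wedgeD_zero (Λ : Multivector A L 2) (f : A) (β : Form A L 0) :
    bracketD R Λ 0 (wedgeD f β) = -lieDeriv (sharp (differential L f) Λ) β := by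
  rw [bracketD_zero, extD_wedgeD, map_neg, contractBi_wedgeD_one_form, contract_extD_zero_form]

/-- Moving `df` past `d` and `i(Λ)` leaves the terms `i_{#df} dβ` and `d i_{#df} β`, which Cartan's
formula combines into a Lie derivative. -/
lemma bracketD_wedgeD_succ (Λ : Multivector A L 2) (f : A) : ∀ {k : ℕ} (β : Form A L (k + 1)),
    bracketD R Λ (k + 1) (wedgeD f β) =
      -lieDeriv (sharp (differential L f) Λ) β - wedgeD f (bracketD R Λ k β)
  | 0, β => by
    simp only [bracketD_succ, bracketD_zero, extD_wedgeD, map_neg, contractBi_wedgeD,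
      contractBi_wedgeD_one_form, contract_extD]
    abel
  | k + 1, β => by
    simp only [bracketD_succ, extD_wedgeD, map_neg, contractBi_wedgeD, contract_extD, extD_add,
      wedgeD_sub]
    abel

lemma boundaryFst_apply (Λ : Multivector A L 2) (E : L) (α : Form A L (k + 1))
    (β : Form A L k) :
    boundaryFst R Λ E k (α, (lowerEquiv R A L k).symm β) =
      bracketD R Λ k α + (k + 1 : A) • contract E α + (-1 : A) ^ (k + 1) • lieDeriv E β := by
  have h : boundaryFst R Λ E k (α, (lowerEquiv R A L k).symm β) =
    bracketD R Λ k α + ((k + 1 : ℕ) : R) • contract E α +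
      (-1 : R) ^ (k + 1) • lieDeriv E β := rfl
  rw [h, Form.scalar_smul, Form.scalar_smul ((-1 : R) ^ (k + 1))]
  simp

lemma boundarySnd_succ_apply (Λ : Multivector A L 2) (E : L) (α : Form A L (k + 2))
    (β : Form A L (k + 1)) :
    boundarySnd R Λ E (k + 1) (α, (lowerEquiv R A L (k + 1)).symm β) =
      (lowerEquiv R A L k).symm (bracketD R Λ k β + (k + 1 : A) • contract E β +
        (-1 : A) ^ k • contractBi Λ α) := by
  have h : boundarySnd R Λ E (k + 1) (α, (lowerEquiv R A L (k + 1)).symm β) =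
    (lowerEquiv R A L k).symm (bracketD R Λ k β + ((k + 1 : ℕ) : R) • contract E β +
      (-1 : R) ^ (k + 2) • contractBi Λ α) := rfl
  rw [h, Form.scalar_smul, Form.scalar_smul ((-1 : R) ^ (k + 2))]
  simp [pow_add]

/-! ### The conformal change of the boundary operator -/

/-- The vector field `#_Λ(da) + a E` of the conformally changed structure. -/
def conformalVF (Λ : Multivector A L 2) (E : L) (a : A) : L :=
  sharp (differential L a) Λ + a • E

/-- The bottom square `r = 1`: the isomorphism is the identity on `0`-chains. The two occurrences of
`E(a)β`, from `i_E(da ∧ β)` and from `L_E(aβ)`, cancel. -/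
lemma conformal_boundaryFst_zero (Λ : Multivector A L 2) (E : L) (a : A) (α : Form A L 1)
    (β : Form A L 0) :
    boundaryFst R (a • Λ) (conformalVF Λ E a) 0 (α, (lowerEquiv R A L 0).symm β) =
      boundaryFst R Λ E 0 (a • α + wedgeD a β, (lowerEquiv R A L 0).symm (a • β)) := by
  simp only [boundaryFst_apply, conformalVF, smul_bracketD_zero, add_contract, smul_contract,
    add_lieDeriv, smul_lieDeriv_zero_form, map_add, bracketD_smul, bracketD_wedgeD_zero,
    contract_add, contract_smul, contract_wedgeD_zero_form, lieDeriv_smul]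
  push_cast
  module

lemma conformal_boundarySnd_one (Λ : Multivector A L 2) (E : L) (a : A) (α : Form A L 2)
    (β : Form A L 1) :
    a ^ (0 + 1) • (bracketD R (a • Λ) 0 β + ((0 : ℕ) + 1 : A) • contract (conformalVF Λ E a) β +
        (-1 : A) ^ 0 • contractBi (a • Λ) α) =
      bracketD R Λ 0 (a ^ (0 + 2) • β) + ((0 : ℕ) + 1 : A) • contract E (a ^ (0 + 2) • β) +
        (-1 : A) ^ 0 • contractBi Λ (a ^ (0 + 2) • α + ((-1) ^ (0 + 1) * a ^ (0 + 1)) • wedgeD a β) := by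
  simp only [conformalVF, smul_bracketD_zero, add_contract, smul_contract, bracketD_smul,
    contract_smul, map_add, map_smul, LinearMap.smul_apply, contractBi_wedgeD_one_form,
    sharp_differential_pow _ a (0 + 1)]
  push_cast
  module

/-- Here `r = k + 3`. On the right `i_{#da} β` appears `k + 3` times from differentiating `a^{k+3}`
and is removed once by `i(Λ)(da ∧ β)`. This leaves the factor `r - 1 = k + 2` of the boundary. -/
lemma conformal_boundarySnd_succ (Λ : Multivector A L 2) (E : L) (a : A)
    (α : Form A L (k + 3)) (β : Form A L (k + 2)) :
    a ^ (k + 2) • (bracketD R (a • Λ) (k + 1) β +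
        ((k + 1 : ℕ) + 1 : A) • contract (conformalVF Λ E a) β +
        (-1 : A) ^ (k + 1) • contractBi (a • Λ) α) =
      bracketD R Λ (k + 1) (a ^ (k + 3) • β) +
        ((k + 1 : ℕ) + 1 : A) • contract E (a ^ (k + 3) • β) +
        (-1 : A) ^ (k + 1) • contractBi Λ
          (a ^ (k + 3) • α + ((-1) ^ (k + 2) * a ^ (k + 2)) • wedgeD a β) := by
  simp only [conformalVF, smul_bracketD_succ, add_contract, smul_contract, bracketD_smul,
    contract_smul, map_add, map_smul, LinearMap.smul_apply, contractBi_wedgeD,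
    sharp_differential_pow _ a (k + 2)]
  push_cast
  rcases neg_one_pow_eq_or A k with h | h <;> simp only [pow_add, h] <;> module

/-- The main computation, with `r = k + 2`. The terms `da ∧ i(Λ)α` cancel on the left, and the terms
`E(a)β` cancel on the right. The term `da ∧ i_E β` occurs `k + 2` times on each side: on the left
once from `L_{aE}` and `k + 1` times from the second component. -/
lemma conformal_boundaryFst_succ (Λ : Multivector A L 2) (E : L) (a : A)
    (α : Form A L (k + 2)) (β : Form A L (k + 1)) :
    a ^ (k + 1) • (bracketD R (a • Λ) (k + 1) α +
        ((k + 1 : ℕ) + 1 : A) • contract (conformalVF Λ E a) α +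
        (-1 : A) ^ (k + 2) • lieDeriv (conformalVF Λ E a) β) +
      ((-1) ^ k * a ^ k) • wedgeD a (bracketD R (a • Λ) k β +
        (k + 1 : A) • contract (conformalVF Λ E a) β + (-1 : A) ^ k • contractBi (a • Λ) α) =
      bracketD R Λ (k + 1) (a ^ (k + 2) • α + ((-1) ^ (k + 1) * a ^ (k + 1)) • wedgeD a β) +
        ((k + 1 : ℕ) + 1 : A) • contract E
          (a ^ (k + 2) • α + ((-1) ^ (k + 1) * a ^ (k + 1)) • wedgeD a β) +
        (-1 : A) ^ (k + 2) • lieDeriv E (a ^ (k + 2) • β) := by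
  have hs : contract (sharp (differential L a) Λ) (wedgeD a β) =
      -wedgeD a (contract (sharp (differential L a) Λ) β) := by
    rw [contract_wedgeD, sharp_differential_lie_self, zero_smul, zero_sub]
  -- The coefficient of `da ∧ β` is itself a function that `bracketD_smul` differentiates; its sign
  -- is a constant and passes through `d`.
  have hp : sharp (differential L ((-1) ^ (k + 1) * a ^ (k + 1))) Λ =
      ((-1) ^ (k + 1) * ((k + 1 : A) * a ^ k)) • sharp (differential L a) Λ := by
    rcases neg_one_pow_eq_or A (k + 1) with h | h
    · rw [h, one_mul, one_mul, sharp_differential_pow]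
    · have e : differential L (-a ^ (k + 1)) = (-1 : A) • differential L (a ^ (k + 1)) := by
        ext X
        simp [differential_apply]
      rw [h, neg_one_mul, e, sharp_smul, sharp_differential_pow, smul_smul]
  simp only [conformalVF, smul_bracketD_succ, wedgeD_smul_bracketD, add_contract, smul_contract,
    map_add, map_smul, LinearMap.smul_apply, bracketD_smul, bracketD_wedgeD_succ, contract_add,
    contract_smul, contract_wedgeD, lieDeriv_smul, add_lieDeriv, smul_lieDeriv, wedgeD_add,
    wedgeD_smul, hp, sharp_differential_pow _ a (k + 1), hs,
    LieRinehartRing.lie_smul_eq_mul, sharp_differential_lie_self, lie_pow E a (k + 1)]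
  push_cast
  -- Fixing the value of `(-1)^k` removes the products of sign powers, leaving polynomial
  -- coefficients for `module`.
  rcases neg_one_pow_eq_or A k with h | h <;> simp only [pow_add, h] <;> module

/-! ### The isomorphism of complexes -/

lemma exists_chain_eq (x : LJChain A L (k + 1)) : ∃ (α : Form A L (k + 1)) (β : Form A L k),
    x = (LJChain.equiv R A L (k + 1)).symm (α, (lowerEquiv R A L k).symm β) :=
  ⟨x.1, x.2, rfl⟩

lemma Form.smul_scalar_comm (f : A) (r : R) (α : Form A L k) : f • r • α = r • f • α := by
  ext v; simp

lemma wedgeD_scalar_smul (f : A) (r : R) (β : Form A L k) :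
    wedgeD f (r • β) = r • wedgeD f β := by
  rw [Form.scalar_smul, wedgeD_smul, ← Form.scalar_smul]

variable (R) in
/-- The endomorphism `(α, β) ↦ (g α + h da ∧ β, g β)` of the chains in positive degree. -/
def shear (a g h : A) (k : ℕ) : LJChain A L (k + 1) →ₗ[R] LJChain A L (k + 1) where
  toFun x := (LJChain.equiv R A L (k + 1)).symm
    (g • x.1 + h • wedgeD a (lowerEquiv R A L k x.2),
      (lowerEquiv R A L k).symm (g • lowerEquiv R A L k x.2))
  map_add' x y := by
    obtain ⟨α, β, rfl⟩ := exists_chain_eq (R := R) x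
    obtain ⟨α', β', rfl⟩ := exists_chain_eq (R := R) y
    refine Prod.ext ?_ ?_
    · change g • (α + α') + h • wedgeD a (β + β') =
        g • α + h • wedgeD a β + (g • α' + h • wedgeD a β')
      rw [wedgeD_add]
      module
    · exact smul_add g β β'
  map_smul' r x := by
    obtain ⟨α, β, rfl⟩ := exists_chain_eq (R := R) x
    refine Prod.ext ?_ ?_
    · change g • r • α + h • wedgeD a (r • β) = r • (g • α + h • wedgeD a β)
      rw [wedgeD_scalar_smul, Form.smul_scalar_comm, Form.smul_scalar_comm, smul_add]
    · exact Form.smul_scalar_comm g r β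

lemma shear_mk (a g h : A) (α : Form A L (k + 1)) (β : Form A L k) :
    shear R a g h k
        ((LJChain.equiv R A L (k + 1)).symm (α, (lowerEquiv R A L k).symm β)) =
      (LJChain.equiv R A L (k + 1)).symm
        (g • α + h • wedgeD a β, (lowerEquiv R A L k).symm (g • β)) := rfl

/-- Shears compose like upper triangular matrices with equal diagonal entries: the pairs `(g, h)`
and `(g', h')` give `(g g', g h' + h g')`. -/
lemma shear_shear (a g h g' h' : A) (hg : g * g' = 1) (hh : g * h' + h * g' = 0)
    (x : LJChain A L (k + 1)) : shear R a g h k (shear R a g' h' k x) = x := by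
  obtain ⟨α, β, rfl⟩ := exists_chain_eq (R := R) x
  rw [shear_mk, shear_mk]
  congr 2
  · rw [wedgeD_smul, smul_add, smul_smul, smul_smul, smul_smul, hg, add_assoc, ← add_smul, hh,
      zero_smul, one_smul, add_zero]
  · rw [smul_smul, hg, one_smul]

variable (R L) in
/-- The isomorphism from the chains of the conformal change by `a` to the original chains:
`(α, β) ↦ (a^r α + (-1)^{r+1} a^{r-1} da ∧ β, a^r β)` in degree `r`. -/
def conformalEquiv (a : Aˣ) : ∀ k, LJChain A L k ≃ₗ[R] LJChain A L k
  -- In degree `0` the factor is `a^0` and there is no second component.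
  | 0 => LinearEquiv.refl R _
  | k + 1 => LinearEquiv.ofLinearMap
      (shear R (a : A) ((a : A) ^ (k + 1)) ((-1) ^ k * (a : A) ^ k) k)
      -- The off-diagonal entry of the inverse is `-h / g²` with `g = a^{k+1}` and `h = (-1)^k a^k`.
      (shear R (a : A) (((a⁻¹ : Aˣ) : A) ^ (k + 1)) (-((-1) ^ k * ((a⁻¹ : Aˣ) : A) ^ (k + 2))) k)
      (LinearMap.ext fun x => shear_shear _ _ _ _ _ (by rw [← mul_pow]; simp) (by
        have h : (a : A) * ((a⁻¹ : Aˣ) : A) = 1 := by simp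
        have h' : (a : A) ^ k * ((a⁻¹ : Aˣ) : A) ^ k = 1 := by rw [← mul_pow, h, one_pow]
        linear_combination (-(-1) ^ k * (a : A) ^ k * ((a⁻¹ : Aˣ) : A) ^ (k + 1)) * h) x)
      (LinearMap.ext fun x => shear_shear _ _ _ _ _ (by rw [← mul_pow]; simp) (by
        have h : (a : A) * ((a⁻¹ : Aˣ) : A) = 1 := by simp
        linear_combination (-(-1) ^ k * (a : A) ^ k * ((a⁻¹ : Aˣ) : A) ^ (k + 1)) * h) x)

lemma boundary_zero_mk (Λ : Multivector A L 2) (E : L) (α : Form A L 1)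
    (β : LowerForm A L 1) :
    boundary R Λ E 0 ((LJChain.equiv R A L 1).symm (α, β)) =
      (LJChain.equiv R A L 0).symm (boundaryFst R Λ E 0 (α, β), 0) := rfl

lemma boundary_mk (Λ : Multivector A L 2) (E : L) (α : Form A L (k + 1))
    (β : LowerForm A L (k + 1)) :
    boundary R Λ E k ((LJChain.equiv R A L (k + 1)).symm (α, β)) =
      (LJChain.equiv R A L k).symm
        (boundaryFst R Λ E k (α, β), boundarySnd R Λ E k (α, β)) := rfl

lemma conformalEquiv_succ_mk (a : Aˣ) (α : Form A L (k + 1)) (β : Form A L k) :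
    conformalEquiv R L a (k + 1)
        ((LJChain.equiv R A L (k + 1)).symm (α, (lowerEquiv R A L k).symm β)) =
      (LJChain.equiv R A L (k + 1)).symm
        ((a : A) ^ (k + 1) • α + ((-1) ^ k * (a : A) ^ k) • wedgeD (a : A) β,
          (lowerEquiv R A L k).symm ((a : A) ^ (k + 1) • β)) := rfl

/-- The chain-map property. Degrees `0` and `1` of the target are separate: the second boundary
component vanishes in the first, and `i(Λ)β` is absent for a `1`-form `β` in the second. -/
lemma conformalEquiv_boundary (Λ : Multivector A L 2) (E : L) (a : Aˣ) :
    ∀ (k : ℕ) (x : LJChain A L (k + 1)),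
      conformalEquiv R L a k (boundary R ((a : A) • Λ) (conformalVF Λ E a) k x) =
        boundary R Λ E k (conformalEquiv R L a (k + 1) x)
  | 0, x => by
    obtain ⟨α, β, rfl⟩ := exists_chain_eq (R := R) x
    rw [conformalEquiv_succ_mk, boundary_zero_mk, boundary_zero_mk, conformal_boundaryFst_zero]
    simp only [zero_add, pow_one, pow_zero, mul_one, one_smul]
    rfl
  | 1, x => by
    obtain ⟨α, β, rfl⟩ := exists_chain_eq (R := R) x
    rw [conformalEquiv_succ_mk, boundary_mk, boundary_mk, boundaryFst_apply,
      boundarySnd_succ_apply, boundaryFst_apply, boundarySnd_succ_apply, conformalEquiv_succ_mk,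
      conformal_boundaryFst_succ, conformal_boundarySnd_one]
  | k + 2, x => by
    obtain ⟨α, β, rfl⟩ := exists_chain_eq (R := R) x
    rw [conformalEquiv_succ_mk, boundary_mk, boundary_mk, boundaryFst_apply,
      boundarySnd_succ_apply, boundaryFst_apply, boundarySnd_succ_apply, conformalEquiv_succ_mk,
      conformal_boundaryFst_succ, conformal_boundarySnd_succ]

/-- In positive degree, an injective map intertwining the boundaries preserves their kernels in both
directions; in degree `0` every chain is a cycle. -/
lemma conformalEquiv_map_cycles (Λ : Multivector A L 2) (E : L) (a : Aˣ) (k : ℕ) :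
    (cycles R ((a : A) • Λ) (conformalVF Λ E a) k).map (conformalEquiv R L a k).toLinearMap =
      cycles R Λ E k := by
  cases k with
  | zero => exact Submodule.map_top _ |>.trans (LinearEquiv.range _)
  | succ k =>
    ext x
    rw [Submodule.mem_map_equiv]
    change boundary R _ _ k _ = 0 ↔ boundary R Λ E k x = 0
    rw [← (conformalEquiv R L a k).map_eq_zero_iff, conformalEquiv_boundary,
      LinearEquiv.apply_symm_apply]

lemma conformalEquiv_map_range (Λ : Multivector A L 2) (E : L) (a : Aˣ) (k : ℕ) :
    (LinearMap.range (boundary R ((a : A) • Λ) (conformalVF Λ E a) k)).map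
      (conformalEquiv R L a k).toLinearMap = LinearMap.range (boundary R Λ E k) := by
  have h : (conformalEquiv R L a k).toLinearMap ∘ₗ
      boundary R ((a : A) • Λ) (conformalVF Λ E a) k =
        boundary R Λ E k ∘ₗ (conformalEquiv R L a (k + 1)).toLinearMap :=
    LinearMap.ext (conformalEquiv_boundary Λ E a k)
  rw [← LinearMap.range_comp, h, LinearEquiv.range_comp]

variable (R) in
/-- LJ-homology is invariant under conformal changes. -/
def homologyConformalEquiv (Λ : Multivector A L 2) (E : L) (a : Aˣ) (k : ℕ) :
    LJHomology R ((a : A) • Λ) (conformalVF Λ E a) k ≃ₗ[R] LJHomology R Λ E k :=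
  Submodule.Quotient.equiv _ _
    ((conformalEquiv R L a k).ofSubmodules _ _ (conformalEquiv_map_cycles Λ E a k)) (by
      -- Boundaries were taken inside the cycles, so membership is checked on the underlying chains.
      ext ⟨x, hx⟩
      rw [Submodule.mem_map_equiv]
      change (conformalEquiv R L a k).symm x ∈
        LinearMap.range (boundary R ((a : A) • Λ) (conformalVF Λ E a) k) ↔
          x ∈ LinearMap.range (boundary R Λ E k)
      rw [← conformalEquiv_map_range Λ E a k, Submodule.mem_map_equiv])

end Complex

end LJ

/-! ### Application to smooth functions and vector fields on a manifold. -/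

lemma SmoothFun.isUnit_of_pos {n : ℕ} {M : Type*} [TopologicalSpace M]
    [ChartedSpace (EuclideanSpace ℝ (Fin n)) M] (a : SmoothFun n M) (ha : ∀ x, 0 < a x) :
    IsUnit a :=
  IsUnit.of_mul_eq_one
    ⟨fun x => (a x)⁻¹, fun x =>
      (contDiffAt_inv ℝ (ha x).ne').contMDiffAt.comp x (a.contMDiff x)⟩
    (by ext x; exact mul_inv_cancel₀ (ha x).ne')

end

theorem theorem4p7 {n : ℕ} {M : Type*} [TopologicalSpace M] [T2Space M] [SigmaCompactSpace M]
    [ChartedSpace (EuclideanSpace ℝ (Fin n)) M] [IsManifold (𝓡 n) ∞ M]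
    (Λ : LJ.Multivector (SmoothFun n M) (SmoothVF n M) 2) (E : SmoothVF n M)
    (hJ : LJ.IsJacobi Λ E) (a : SmoothFun n M) (ha : ∀ x, 0 < a x) (k : ℕ) :
    Nonempty (LJ.LJHomology ℝ Λ E k ≃ₗ[ℝ]
      LJ.LJHomology ℝ (a • Λ)
        (LJ.sharp (LJ.differential (SmoothVF n M) a) Λ + a • E) k) := by
  obtain ⟨u, rfl⟩ := a.isUnit_of_pos ha
  -- The constructed isomorphism goes from the changed structure to the original one; `conformalVF`
  -- unfolds to the stated vector field.
  exact ⟨(LJ.homologyConformalEquiv ℝ Λ E u k).symm⟩
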